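/- **Proposition 3.** All random variables are defined on a probability space $(\Omega,\mathcal A,\mathbb P)$. A zero-mean Gauss field on $D\subseteq\mathbb R^2$ is a family $(Y(p))_{p\in D}$ of real random variables with mean zero all of whose finite subfamilies are jointly normal (degenerate normal laws allowed); it has continuous sample paths almost surely if $p\mapsto Y(p)(\omega)$ is continuous on $D$ for almost every $\omega$. Let $\{X(s,t):s,t\in\mathbb R\}$ be a stationary Ornstein–Uhlenbeck field with parameters $(\frac12,\frac12,1)$, that is, a zero-mean Gauss field on $\mathbb R^2$ with almost surely continuous sample paths and $$\operatorname{cov}(X(s_1,t_1),X(s_2,t_2))=\exp\{-\tfrac12|s_2-s_1|-\tfrac12|t_2-t_1|\},\qquad s_1,s_2,t_1,t_2\in\mathbb R$$ (for instance $X(s,t)=e^{-(s+t)/2}\,W(e^{s},e^{t})$ with a standard Wiener field $W$). Let $S,T>0$ and $\alpha,\beta>0$. For $s\in(0,S)$ put $$\sqrt{g^{(\alpha)}_S(s)}:=\begin{cases}(S-s)^\alpha\sqrt{\frac{S^{1-2\alpha}-(S-s)^{1-2\alpha}}{1-2\alpha}}&\text{if }\alpha\ne\frac12,\\ \sqrt{(S-s)\ln\left(\frac{S}{S-s}\right)}&\text{if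 }\alpha=\frac12,\end{cases}$$ $$f^{(\alpha)}_S(s):=\begin{cases}\frac{S^{2\alpha}}{1-2\alpha}\left(S^{1-2\alpha}-(S-s)^{1-2\alpha}\right)&\text{if }\alpha\ne\frac12,\\ S\ln\left(\frac{S}{S-s}\right)&\text{if }\alpha=\frac12,\end{cases}$$ and define $g^{(\beta)}_T(t)$ and $f^{(\beta)}_T(t)$ for $t\in(0,T)$ in the same way, with $\beta,T,t$ in place of $\alpha,S,s$. Then the random field $$U(s,t):=\begin{cases}\sqrt{g^{(\alpha)}_S(s)\,g^{(\beta)}_T(t)}\;X\left(\ln f^{(\alpha)}_S(s),\,\ln f^{(\beta)}_T(t)\right)&\text{if }(s,t)\in(0,S)\times(0,T),\\ 0&\text{if }s\in\{0,S\}\text{ or }t\in\{0,T\},\end{cases}\qquad (s,t)\in[0,S]\times[0,T],$$ is a tied-down scaled Wiener bridge with parameters $(\alpha,\beta)$, that is, a zero-mean Gauss field on $[0,S]\times[0,T]$ with almost surely continuous sample paths and $$\operatorname{cov}(U(s_1,t_1),U(s_2,t_2))=R^{(\alpha)}_S(s_1,s_2)\,R^{(\beta)}_T(t_1,t_2),\qquad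 (s_1,t_1),(s_2,t_2)\in[0,S]\times[0,T],$$ where $$R^{(\alpha)}_S(s_1,s_2)=\begin{cases}\frac{(S-s_1)^\alpha(S-s_2)^\alpha}{1-2\alpha}\left(S^{1-2\alpha}-(S-(s_1\wedge s_2))^{1-2\alpha}\right)&\text{if }\alpha\ne\frac12,\\ \sqrt{(S-s_1)(S-s_2)}\,\ln\left(\frac{S}{S-(s_1\wedge s_2)}\right)&\text{if }\alpha=\frac12,\end{cases}\qquad s_1,s_2\in[0,S),$$ $R^{(\alpha)}_S(s_1,s_2)=0$ if $s_1=S$ or $s_2=S$, and $R^{(\beta)}_T$ is defined in the same way with $\beta,T$ in place of $\alpha,S$. -/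

import Mathlib

open MeasureTheory ProbabilityTheory Set

noncomputable section

/-- The real random variables `Y p`, `p ∈ D`, where `D` is a subset of the plane, form a zero-mean
Gauss field on `D` whose sample paths are almost surely continuous on `D` and whose covariance
function is `R`. Every finite family of these variables is jointly normal, degenerate normal
distributions (such as the point mass at zero) being allowed. -/
structure IsCenteredGaussField {Ω : Type*} [MeasurableSpace Ω] (P : Measure Ω)
    (D : Set (ℝ × ℝ)) (R : ℝ × ℝ → ℝ × ℝ → ℝ) (Y : ℝ × ℝ → Ω → ℝ) : Prop where
  measurable : ∀ p ∈ D, Measurable (Y p)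
  gaussian : IsGaussianProcess (fun p : D => Y p) P
  mean_zero : ∀ p ∈ D, ∫ ω, Y p ω ∂P = 0
  continuous_paths : ∀ᵐ ω ∂P, ContinuousOn (fun p => Y p ω) D
  cov_eq : ∀ p ∈ D, ∀ q ∈ D, covariance (Y p) (Y q) P = R p q

/-- A stationary Ornstein-Uhlenbeck field on the plane with parameters `(a, b, σ)`
(of interest for `a, b, σ > 0`). -/
def IsStationaryOUField {Ω : Type*} [MeasurableSpace Ω] (P : Measure Ω) (a b σ : ℝ)
    (X : ℝ × ℝ → Ω → ℝ) : Prop :=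
  IsCenteredGaussField P univ
    (fun p q => σ ^ 2 / (4 * a * b) * Real.exp (-a * |q.1 - p.1| - b * |q.2 - p.2|)) X

/-- The covariance function of a scaled Wiener bridge on `[0, S]` with parameter `α`. -/
def scaledBridgeCov (S α s₁ s₂ : ℝ) : ℝ :=
  if s₁ = S ∨ s₂ = S then 0
  else if α = 1 / 2 then
    √((S - s₁) * (S - s₂)) * Real.log (S / (S - min s₁ s₂))
  else
    (S - s₁) ^ α * (S - s₂) ^ α / (1 - 2 * α)
      * (S ^ (1 - 2 * α) - (S - min s₁ s₂) ^ (1 - 2 * α))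

/-- A tied-down scaled Wiener bridge on `[0, S] × [0, T]` with parameters `(α, β)`. -/
def IsTiedDownScaledWienerBridge {Ω : Type*} [MeasurableSpace Ω] (P : Measure Ω)
    (S T α β : ℝ) (Y : ℝ × ℝ → Ω → ℝ) : Prop :=
  IsCenteredGaussField P (Icc 0 S ×ˢ Icc 0 T)
    (fun p q => scaledBridgeCov S α p.1 q.1 * scaledBridgeCov T β p.2 q.2) Y

/-- The square root of the scaling function `g` of the amplitude, for `s ∈ (0, S)`. -/
def bridgeSqrtG (S α s : ℝ) : ℝ :=
  if α = 1 / 2 then √((S - s) * Real.log (S / (S - s)))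
  else (S - s) ^ α * √((S ^ (1 - 2 * α) - (S - s) ^ (1 - 2 * α)) / (1 - 2 * α))

/-- The scaling function `g` of the amplitude, for `s ∈ (0, S)`. -/
def bridgeG (S α s : ℝ) : ℝ := bridgeSqrtG S α s ^ 2

/-- The scaling function `f` of the domain, for `s ∈ (0, S)`. -/
def bridgeF (S α s : ℝ) : ℝ :=
  if α = 1 / 2 then S * Real.log (S / (S - s))
  else S ^ (2 * α) / (1 - 2 * α) * (S ^ (1 - 2 * α) - (S - s) ^ (1 - 2 * α))

/-- The space-domain scaled field obtained from `X`: on the open rectangle `(0, S) × (0, T)` it is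
`√(g(s) g(t)) X(ln f(s), ln f(t))`, on the boundary of the rectangle it is zero. (Values outside
the closed rectangle are irrelevant.) -/
def scaledField {Ω : Type*} (S T α β : ℝ) (X : ℝ × ℝ → Ω → ℝ) (p : ℝ × ℝ) (ω : Ω) : ℝ :=
  if (0 < p.1 ∧ p.1 < S) ∧ (0 < p.2 ∧ p.2 < T) then
    √(bridgeG S α p.1 * bridgeG T β p.2)
      * X (Real.log (bridgeF S α p.1), Real.log (bridgeF T β p.2)) ω
  else 0

end

/-! Measurability, Gaussianity and zero mean pass to `U`, since each value of `U` is a deterministic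
multiple of a value of `X` (`scaledField_eq`). The covariance reduces to one coordinate: with x =
ln(S/(S-s)) one has √g = exp(-αx)√f. Since f is nondecreasing, exp(-½|ln f(s₂) - ln f(s₁)|) is the
square root of the smaller value of f over the larger, which turns the product into the bridge
covariance (`scaledBridgeCov_eq`). The real work is path continuity at the boundary, where ln f may
tend to ±∞. Kolmogorov-type chaining over dyadic grids of the whole plane, using twelfth moments,
gives almost surely |X(u,v)| ≤ C(1+u²)(1+v²) (`ae_exists_growth_bound_of_isStationaryOUField`). On
the other side √g·(1+ln²f) tends to 0 at both ends of the interval (`continuousOn_bridgeEnvelope`),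
so `U` is squeezed to 0. -/

/-! ### Moment bounds for countable Gaussian families -/

open Filter Topology ENNReal in
theorem exists_lintegral_enorm_pow_le_of_hasGaussianLaw : ∃ c : ℝ≥0∞, c ≠ ∞ ∧
    ∀ {Ω : Type*} [MeasurableSpace Ω] (P : Measure Ω) (Y : Ω → ℝ) (v : ℝ),
      HasGaussianLaw Y P → ∫ ω, Y ω ∂P = 0 → variance Y P ≤ v →
        ∫⁻ ω, ‖Y ω‖ₑ ^ 12 ∂P ≤ c * ENNReal.ofReal (v ^ 6) := by
  refine ⟨∫⁻ x, ‖x‖ₑ ^ 12 ∂(gaussianReal 0 1), ?_, ?_⟩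
  · have h := (memLp_id_gaussianReal (μ := 0) (v := 1) 12).2
    rw [eLpNorm_lt_top_iff_lintegral_rpow_enorm_lt_top (by simp) (by simp)] at h
    convert h.ne using 4 with x
    exact (ENNReal.rpow_natCast ‖x‖ₑ 12).symm
  · intro Ω _ P Y v hY h0 hv
    have hvar : 0 ≤ variance Y P := variance_nonneg Y P
    set σ := √(variance Y P) with hσ
    -- A centred normal variable is σ times a standard one in law, so its twelfth moment is σ¹²
    -- times a universal constant.
    have hmap : P.map Y = (gaussianReal 0 1).map (σ * ·) := by
      rw [hY.map_eq_gaussianReal, h0, gaussianReal_map_const_mul]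
      congr 1
      · simp
      · ext; simp [hσ, hvar, Real.sq_sqrt]
    have hm : Measurable fun x : ℝ => ‖x‖ₑ ^ 12 := by fun_prop
    rw [← lintegral_map' (f := fun x : ℝ => ‖x‖ₑ ^ 12) hm.aemeasurable hY.aemeasurable, hmap,
      lintegral_map hm (by fun_prop), mul_comm, ← lintegral_const_mul _ hm]
    refine lintegral_mono fun x => ?_
    simp only [enorm_mul, mul_pow]
    gcongr
    rw [← enorm_pow, Real.enorm_eq_ofReal (by positivity)]
    apply ENNReal.ofReal_le_ofReal
    have : σ ^ 12 = (variance Y P) ^ 6 := by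
      rw [show 12 = 2 * 6 from rfl, pow_mul, hσ, Real.sq_sqrt hvar]
    rw [this]
    gcongr

/-- The sum of b k · |Y k|¹² / (v k)⁶ has finite expectation, hence is almost surely finite. Its
value serves as `K`, uniformly in k. -/
theorem ae_exists_pow_mul_le_of_hasGaussianLaw {Ω ι : Type*} [MeasurableSpace Ω] [Countable ι]
    (P : Measure Ω) (Y : ι → Ω → ℝ) (v b : ι → ℝ) (hm : ∀ k, Measurable (Y k))
    (hY : ∀ k, HasGaussianLaw (Y k) P) (h0 : ∀ k, ∫ ω, Y k ω ∂P = 0)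
    (hv : ∀ k, variance (Y k) P ≤ v k) (hv0 : ∀ k, 0 < v k) (hb : ∀ k, 0 < b k)
    (hs : Summable b) :
    ∀ᵐ ω ∂P, ∃ K : ℝ, 0 ≤ K ∧ ∀ k, |Y k ω| ^ 12 * b k ≤ K * v k ^ 6 := by
  obtain ⟨c, hc, hcY⟩ := exists_lintegral_enorm_pow_le_of_hasGaussianLaw
  have hme : ∀ k, Measurable fun ω => ENNReal.ofReal (b k / v k ^ 6) * ‖Y k ω‖ₑ ^ 12 :=
    fun k => by have := hm k; fun_prop
  have hfin : ∫⁻ ω, ∑' k, ENNReal.ofReal (b k / v k ^ 6) * ‖Y k ω‖ₑ ^ 12 ∂P ≠ ⊤ := by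
    rw [lintegral_tsum fun k => (hme k).aemeasurable]
    have hle : ∀ k, ∫⁻ ω, ENNReal.ofReal (b k / v k ^ 6) * ‖Y k ω‖ₑ ^ 12 ∂P
        ≤ c * ENNReal.ofReal (b k) := by
      intro k
      rw [lintegral_const_mul _ (by have := hm k; fun_prop)]
      calc _ ≤ ENNReal.ofReal (b k / v k ^ 6) * (c * ENNReal.ofReal (v k ^ 6)) := by
            gcongr; exact hcY P (Y k) (v k) (hY k) (h0 k) (hv k)
        _ = c * (ENNReal.ofReal (b k / v k ^ 6) * ENNReal.ofReal (v k ^ 6)) := by ring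
        _ = c * ENNReal.ofReal (b k) := by
            have := hv0 k
            have := hb k
            rw [← ENNReal.ofReal_mul (by positivity), div_mul_cancel₀ _ (by positivity)]
    refine ne_top_of_le_ne_top ?_ (ENNReal.tsum_le_tsum hle)
    rw [ENNReal.tsum_mul_left]
    exact ENNReal.mul_ne_top hc hs.tsum_ofReal_ne_top
  filter_upwards [ae_lt_top' (AEMeasurable.tsum fun k => (hme k).aemeasurable) hfin]
    with ω hω
  refine ⟨(∑' k, ENNReal.ofReal (b k / v k ^ 6) * ‖Y k ω‖ₑ ^ 12).toReal, ENNReal.toReal_nonneg,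
    fun k => ?_⟩
  have h1 := ENNReal.toReal_mono hω.ne
    (ENNReal.le_tsum (f := fun k => ENNReal.ofReal (b k / v k ^ 6) * ‖Y k ω‖ₑ ^ 12) k)
  have := hv0 k
  have := hb k
  simp only [ENNReal.toReal_mul, ENNReal.toReal_pow, toReal_enorm, Real.norm_eq_abs] at h1
  rw [ENNReal.toReal_ofReal (by positivity), div_mul_eq_mul_div, div_le_iff₀ (by positivity)] at h1
  linarith

/-! ### Dyadic approximation in the plane -/

theorem summable_inv_one_add_sq_int : Summable fun i : ℤ => (1 + (i : ℝ) ^ 2)⁻¹ := by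
  refine Summable.of_norm_bounded_eventually (Real.summable_one_div_int_pow.2 one_lt_two) ?_
  filter_upwards [Filter.eventually_cofinite_ne (0 : ℤ)] with i hi
  have : (0 : ℝ) < (i : ℝ) ^ 2 := by positivity
  rw [Real.norm_of_nonneg (by positivity), one_div]
  gcongr
  linarith

/-- The finer grid index determines the coarser one, so the chaining increments form a countable
family indexed by level and fine grid point. -/
theorem floor_two_pow_succ_ediv (n : ℕ) (x : ℝ) :
    ⌊(2 : ℝ) ^ (n + 1) * x⌋ / 2 = ⌊(2 : ℝ) ^ n * x⌋ := by
  symm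
  rw [Int.floor_eq_iff]
  have h1 := Int.floor_le ((2 : ℝ) ^ (n + 1) * x)
  have h2 := Int.lt_floor_add_one ((2 : ℝ) ^ (n + 1) * x)
  set i := ⌊(2 : ℝ) ^ (n + 1) * x⌋
  have h3 : 2 * ((i / 2 : ℤ) : ℝ) ≤ i := by exact_mod_cast (by omega : 2 * (i / 2) ≤ i)
  have h4 : (i : ℝ) + 1 ≤ 2 * ((i / 2 : ℤ) : ℝ) + 2 := by
    exact_mod_cast (by omega : i + 1 ≤ 2 * (i / 2) + 2)
  rw [pow_succ] at h1 h2
  constructor <;> linarith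

theorem one_add_floor_two_pow_mul_sq_le (n : ℕ) (x : ℝ) :
    1 + (⌊(2 : ℝ) ^ n * x⌋ : ℝ) ^ 2 ≤ 3 * 4 ^ n * (1 + x ^ 2) := by
  have h1 := Int.floor_le ((2 : ℝ) ^ n * x)
  have h2 := Int.lt_floor_add_one ((2 : ℝ) ^ n * x)
  set i : ℝ := ((⌊(2 : ℝ) ^ n * x⌋ : ℤ) : ℝ)
  set z := (2 : ℝ) ^ n * x with hz
  have h4 : (4 : ℝ) ^ n = (2 ^ n) ^ 2 := by rw [← pow_mul, mul_comm, pow_mul]; norm_num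
  have h5 : (4 : ℝ) ^ n * x ^ 2 = z ^ 2 := by rw [h4, hz]; ring
  have h6 : (1 : ℝ) ≤ 4 ^ n := one_le_pow₀ (by norm_num)
  have h7 : i ^ 2 ≤ 2 * z ^ 2 + 2 := by nlinarith [sq_nonneg (i - 2 * z), sq_nonneg (i - z)]
  nlinarith [sq_nonneg z]

theorem tendsto_floor_two_pow_mul_div (x : ℝ) :
    Filter.Tendsto (fun n : ℕ => (⌊(2 : ℝ) ^ n * x⌋ : ℝ) / 2 ^ n) Filter.atTop (nhds x) := by
  have h0 : Filter.Tendsto (fun n : ℕ => x - (1 / 2) ^ n) Filter.atTop (nhds x) := by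
    simpa using (tendsto_pow_atTop_nhds_zero_of_lt_one (r := (1 / 2 : ℝ)) (by norm_num)
      (by norm_num)).const_sub x
  refine tendsto_of_tendsto_of_tendsto_of_le_of_le h0 tendsto_const_nhds (fun n => ?_) fun n => ?_
  · have := Int.lt_floor_add_one ((2 : ℝ) ^ n * x)
    dsimp only
    rw [le_div_iff₀ (by positivity), sub_mul, ← mul_pow]
    norm_num
    linarith
  · have := Int.floor_le ((2 : ℝ) ^ n * x)
    dsimp only
    rw [div_le_iff₀ (by positivity)]
    linarith

/-- Telescoping along the dyadic approximations of (x, y) and a geometric series; continuity passes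
the bound to the limit. -/
theorem abs_le_of_dyadic_increments (F : ℝ × ℝ → ℝ) (hF : Continuous F) (x y A r : ℝ)
    (hA : 0 ≤ A) (hr0 : 0 ≤ r) (hr : r < 1) (h0 : |F (⌊x⌋, ⌊y⌋)| ≤ A)
    (h : ∀ n : ℕ, |F (⌊(2 : ℝ) ^ (n + 1) * x⌋ / 2 ^ (n + 1), ⌊(2 : ℝ) ^ (n + 1) * y⌋ / 2 ^ (n + 1))
      - F (⌊(2 : ℝ) ^ n * x⌋ / 2 ^ n, ⌊(2 : ℝ) ^ n * y⌋ / 2 ^ n)| ≤ A * r ^ n) :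
    |F (x, y)| ≤ A * (1 + (1 - r)⁻¹) := by
  set G : ℕ → ℝ := fun n => F (⌊(2 : ℝ) ^ n * x⌋ / 2 ^ n, ⌊(2 : ℝ) ^ n * y⌋ / 2 ^ n) with hG
  have hlim : Filter.Tendsto G Filter.atTop (nhds (F (x, y))) :=
    (hF.tendsto (x, y)).comp
      ((tendsto_floor_two_pow_mul_div x).prodMk_nhds (tendsto_floor_two_pow_mul_div y))
  refine le_of_tendsto hlim.abs (Filter.Eventually.of_forall fun N => ?_)
  have hsum : ∑ n ∈ Finset.range N, r ^ n ≤ (1 - r)⁻¹ := by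
    rw [← tsum_geometric_of_lt_one hr0 hr]
    exact (summable_geometric_of_lt_one hr0 hr).sum_le_tsum _ fun i _ => by positivity
  have key : |G N - G 0| ≤ ∑ n ∈ Finset.range N, A * r ^ n := by
    rw [← Finset.sum_range_sub]
    exact (Finset.abs_sum_le_sum_abs _ _).trans (Finset.sum_le_sum fun n _ => h n)
  rw [← Finset.mul_sum] at key
  have hG0 : |G 0| ≤ A := by simpa [hG] using h0
  have h1 := abs_sub_abs_le_abs_sub (G N) (G 0)
  nlinarith [mul_le_mul_of_nonneg_left hsum hA]

theorem le_mul_of_pow_twelve_le {a B q r : ℝ} (hB : 1 ≤ B) (hr : 0 ≤ r)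
    (hq : q ≤ r ^ 12) (h : a ^ 12 ≤ B * q) : a ≤ B * r := by
  refine le_of_pow_le_pow_left₀ (n := 12) (by norm_num) (by positivity) ?_
  calc a ^ 12 ≤ B * q := h
    _ ≤ B * r ^ 12 := by gcongr
    _ ≤ B ^ 12 * r ^ 12 := by
        gcongr
        exact le_self_pow₀ hB (n := 12) (by norm_num)
    _ = (B * r) ^ 12 := (mul_pow _ _ _).symm

/-! ### Polynomial growth of the Ornstein–Uhlenbeck paths -/

/-- The variance is 2 - 2exp(-d/2), with d the ℓ¹ distance, and exp(-d/2) ≥ 1 - d/2. -/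
theorem variance_sub_le_of_isStationaryOUField {Ω : Type*} [MeasurableSpace Ω] {P : Measure Ω}
    {X : ℝ × ℝ → Ω → ℝ} (hX : IsStationaryOUField P (1 / 2) (1 / 2) 1 X) (p q : ℝ × ℝ) :
    variance (fun ω => X p ω - X q ω) P ≤ |q.1 - p.1| + |q.2 - p.2| := by
  have hg := fun p : ℝ × ℝ => hX.gaussian.hasGaussianLaw_eval ⟨p, mem_univ p⟩
  have := (hg p).isProbabilityMeasure
  have hc := fun p q => hX.cov_eq p (mem_univ p) q (mem_univ q)
  have h2 := fun p => (hg p).memLp_two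
  rw [← covariance_self ((hX.measurable p (mem_univ p)).aemeasurable.fun_sub
    (hX.measurable q (mem_univ q)).aemeasurable), covariance_fun_sub_fun_sub (h2 p) (h2 q) (h2 p) (h2 q),
    hc, hc, hc, hc]
  rw [abs_sub_comm p.1 q.1, abs_sub_comm p.2 q.2]
  have := Real.add_one_le_exp (-(1 / 2) * |q.1 - p.1| - 1 / 2 * |q.2 - p.2|)
  norm_num
  norm_num at this
  linarith

theorem ae_exists_growth_bound_of_isStationaryOUField {Ω : Type*} [MeasurableSpace Ω]
    {P : Measure Ω} {X : ℝ × ℝ → Ω → ℝ} (hX : IsStationaryOUField P (1 / 2) (1 / 2) 1 X) :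
    ∀ᵐ ω ∂P, ∃ C : ℝ, ∀ u v : ℝ, |X (u, v) ω| ≤ C * ((1 + u ^ 2) * (1 + v ^ 2)) := by
  have hg := fun p : ℝ × ℝ => hX.gaussian.hasGaussianLaw_eval ⟨p, mem_univ p⟩
  have hm := fun p : ℝ × ℝ => hX.measurable p (mem_univ p)
  have h0 := fun p : ℝ × ℝ => hX.mean_zero p (mem_univ p)
  have hsq : Summable fun k : ℤ × ℤ => (1 + (k.1 : ℝ) ^ 2)⁻¹ * (1 + (k.2 : ℝ) ^ 2)⁻¹ :=
    summable_inv_one_add_sq_int.mul_of_nonneg summable_inv_one_add_sq_int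
      (fun i => by positivity) (fun i => by positivity)
  have hsq' : Summable fun k : ℕ × ℤ × ℤ =>
      (1 / 2 : ℝ) ^ k.1 * ((1 + (k.2.1 : ℝ) ^ 2)⁻¹ * (1 + (k.2.2 : ℝ) ^ 2)⁻¹) :=
    summable_geometric_two.mul_of_nonneg hsq (fun i => by positivity) (fun i => by positivity)
  have hcorner := ae_exists_pow_mul_le_of_hasGaussianLaw P
    (fun k : ℤ × ℤ => X (k.1, k.2)) (fun _ => 1) _ (fun k => hm _) (fun k => hg _) (fun k => h0 _)
    (fun k => by
      rw [← covariance_self (hm _).aemeasurable, hX.cov_eq _ (mem_univ _) _ (mem_univ _)]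
      norm_num) (fun _ => one_pos) (fun k => by positivity) hsq
  -- The index (n, i, j) stands for the step from (i, j)/2^(n+1) to its parent at level n. Each
  -- coordinate moves by at most 2^(-n)/2, so the variance is at most 2^(-n).
  have hinc := ae_exists_pow_mul_le_of_hasGaussianLaw P
    (fun (k : ℕ × ℤ × ℤ) ω => X ((k.2.1 : ℝ) / 2 ^ (k.1 + 1), (k.2.2 : ℝ) / 2 ^ (k.1 + 1)) ω
      - X (((k.2.1 / 2 : ℤ) : ℝ) / 2 ^ k.1, ((k.2.2 / 2 : ℤ) : ℝ) / 2 ^ k.1) ω)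
    (fun k => (1 / 2) ^ k.1) _ (fun k => (hm _).sub (hm _))
    (fun k => hX.gaussian.hasGaussianLaw_fun_sub (s := ⟨_, mem_univ _⟩) (t := ⟨_, mem_univ _⟩))
    (fun k => by rw [integral_sub (hg _).integrable (hg _).integrable, h0, h0, sub_zero])
    (fun k => by
      refine (variance_sub_le_of_isStationaryOUField hX _ _).trans ?_
      have hd : ∀ i : ℤ, |((i / 2 : ℤ) : ℝ) / 2 ^ k.1 - (i : ℝ) / 2 ^ (k.1 + 1)|
          ≤ (1 / 2) ^ k.1 / 2 := by
        intro i
        have h1 : 2 * ((i / 2 : ℤ) : ℝ) ≤ i := by exact_mod_cast (by omega : 2 * (i / 2) ≤ i)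
        have h2 : (i : ℝ) ≤ 2 * ((i / 2 : ℤ) : ℝ) + 1 := by
          exact_mod_cast (by omega : i ≤ 2 * (i / 2) + 1)
        have h3 : ((i / 2 : ℤ) : ℝ) / 2 ^ k.1 - (i : ℝ) / 2 ^ (k.1 + 1)
            = (2 * ((i / 2 : ℤ) : ℝ) - i) * ((1 / 2) ^ k.1 / 2) := by
          rw [one_div, inv_pow, pow_succ]; field_simp
        have h4 : (0 : ℝ) < (1 / 2) ^ k.1 / 2 := by positivity
        rw [h3, abs_mul, abs_of_pos h4]
        have : |2 * ((i / 2 : ℤ) : ℝ) - i| ≤ 1 := abs_le.2 ⟨by linarith, by linarith⟩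
        nlinarith
      have := hd k.2.1
      have := hd k.2.2
      dsimp only
      linarith)
    (fun _ => by positivity) (fun k => by positivity) hsq'
  filter_upwards [hcorner, hinc, hX.continuous_paths] with ω ⟨K₀, hK₀, hc⟩ ⟨K, hK, hi⟩ hcont
  have hcont' : Continuous fun p => X p ω := continuousOn_univ.1 hcont
  -- 9 and 144 = 9·16 come from the floor estimate, squared, at levels 0 and n+1. The 1 makes the
  -- factor at least 1, so that its twelfth root is bounded by itself. The ratio 19/20 satisfies
  -- (19/20)¹² ≥ 1/2.
  refine ⟨(1 + 9 * K₀ + 144 * K) * (1 + (1 - 19 / 20)⁻¹), fun x y => ?_⟩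
  set W := (1 + x ^ 2) * (1 + y ^ 2) with hW
  have hW1 : 1 ≤ W := by nlinarith [sq_nonneg x, sq_nonneg y, mul_nonneg (sq_nonneg x) (sq_nonneg y)]
  have hB : 1 ≤ (1 + 9 * K₀ + 144 * K) * W := by nlinarith
  rw [mul_right_comm]
  refine abs_le_of_dyadic_increments (fun p => X p ω) hcont' x y _ (19 / 20) (by linarith)
    (by norm_num) (by norm_num) ?_ fun n => ?_
  · rw [← mul_one ((1 + 9 * K₀ + 144 * K) * W)]
    refine le_mul_of_pow_twelve_le hB zero_le_one (one_pow 12).ge ?_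
    have h1 := hc (⌊x⌋, ⌊y⌋)
    have hx := one_add_floor_two_pow_mul_sq_le 0 x
    have hy := one_add_floor_two_pow_mul_sq_le 0 y
    simp only [pow_zero, one_mul, mul_one] at hx hy
    simp only [one_pow, mul_one, ← mul_inv] at h1
    rw [← div_eq_mul_inv, div_le_iff₀ (by positivity)] at h1
    have h2 : (1 + (⌊x⌋ : ℝ) ^ 2) * (1 + (⌊y⌋ : ℝ) ^ 2) ≤ 9 * W := by
      calc _ ≤ (3 * (1 + x ^ 2)) * (3 * (1 + y ^ 2)) := by gcongr
        _ = 9 * W := by rw [hW]; ring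
    nlinarith [mul_le_mul_of_nonneg_left h2 hK₀, mul_nonneg hK (zero_le_one.trans hW1)]
  · refine le_mul_of_pow_twelve_le (q := (1 / 2) ^ n) hB (by positivity) ?_ ?_
    · rw [← pow_mul, mul_comm, pow_mul]
      gcongr
      norm_num
    have h1 := hi (n, ⌊(2 : ℝ) ^ (n + 1) * x⌋, ⌊(2 : ℝ) ^ (n + 1) * y⌋)
    have hx := one_add_floor_two_pow_mul_sq_le (n + 1) x
    have hy := one_add_floor_two_pow_mul_sq_le (n + 1) y
    simp only [floor_two_pow_succ_ediv] at h1
    set D := |X (⌊(2 : ℝ) ^ (n + 1) * x⌋ / 2 ^ (n + 1), ⌊(2 : ℝ) ^ (n + 1) * y⌋ / 2 ^ (n + 1)) ω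
      - X (⌊(2 : ℝ) ^ n * x⌋ / 2 ^ n, ⌊(2 : ℝ) ^ n * y⌋ / 2 ^ n) ω|
    set i : ℝ := ((⌊(2 : ℝ) ^ (n + 1) * x⌋ : ℤ) : ℝ)
    set j : ℝ := ((⌊(2 : ℝ) ^ (n + 1) * y⌋ : ℤ) : ℝ)
    have h2 : (1 + i ^ 2) * (1 + j ^ 2) ≤ 144 * 16 ^ n * W := by
      calc _ ≤ (3 * 4 ^ (n + 1) * (1 + x ^ 2)) * (3 * 4 ^ (n + 1) * (1 + y ^ 2)) := by gcongr
        _ = 144 * 16 ^ n * W := by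
          rw [hW, show (16 : ℝ) = 4 * 4 by norm_num, mul_pow]; ring
    have h3 : D ^ 12 ≤ K * ((1 / 2) ^ n) ^ 5 * ((1 + i ^ 2) * (1 + j ^ 2)) := by
      have hpos : (0 : ℝ) < (1 / 2) ^ n := by positivity
      rw [← mul_inv, ← div_eq_mul_inv, mul_div_assoc', div_le_iff₀ (by positivity)] at h1
      refine le_of_mul_le_mul_right ?_ hpos
      calc _ ≤ _ := h1
        _ = _ := by ring
    -- This is where the moment 12 is needed: it yields 2^(-6n), the summation weight costs 2^n and
    -- the number of grid points 16^n, leaving 2^(-n).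
    have h4 : ((1 / 2 : ℝ) ^ n) ^ 5 * 16 ^ n = (1 / 2) ^ n := by
      rw [← pow_mul, mul_comm n, pow_mul, ← mul_pow]; norm_num
    calc D ^ 12 ≤ K * ((1 / 2) ^ n) ^ 5 * (144 * 16 ^ n * W) := h3.trans (by gcongr)
      _ = 144 * K * W * (((1 / 2) ^ n) ^ 5 * 16 ^ n) := by ring
      _ = 144 * K * W * (1 / 2) ^ n := by rw [h4]
      _ ≤ _ := by
        gcongr
        linarith

/-! ### The scaling functions in the variable x = ln(S/(S-s)) -/

open Filter Topology

theorem mul_exp_neg_abs_mul_le_div {c x : ℝ} (hc : c ≠ 0) (hx : 0 ≤ x) :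
    x * Real.exp (-|c| * x) ≤ (1 - Real.exp (-c * x)) / c := by
  rcases lt_or_gt_of_ne hc with h | h
  · rw [le_div_iff_of_neg h, abs_of_neg h]
    have h1 := Real.add_one_le_exp (-c * x)
    have h2 : Real.exp (- -c * x) ≤ 1 := Real.exp_le_one_iff.2 (by nlinarith)
    nlinarith [mul_nonneg (neg_pos.2 h).le hx]
  · rw [le_div_iff₀ h, abs_of_pos h]
    have h1 := Real.add_one_le_exp (c * x)
    have h2 : Real.exp (c * x) * Real.exp (-c * x) = 1 := by rw [← Real.exp_add]; simp
    nlinarith [Real.exp_pos (-c * x)]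

theorem div_le_mul_exp_max_mul {c : ℝ} (hc : c ≠ 0) (x : ℝ) :
    (1 - Real.exp (-c * x)) / c ≤ x * Real.exp (max 0 (-c) * x) := by
  rcases lt_or_gt_of_ne hc with h | h
  · rw [div_le_iff_of_neg h, max_eq_right (by linarith)]
    have h1 := Real.add_one_le_exp (c * x)
    have h2 : Real.exp (c * x) * Real.exp (-c * x) = 1 := by rw [← Real.exp_add]; simp
    nlinarith [Real.exp_pos (-c * x)]
  · rw [div_le_iff₀ h, max_eq_left (by linarith)]
    have h1 := Real.add_one_le_exp (-c * x)
    simp only [zero_mul, Real.exp_zero, mul_one]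
    linarith

theorem sub_eq_mul_exp_neg_log {S s : ℝ} (hS : 0 < S) (hs : s < S) :
    S - s = S * Real.exp (-Real.log (S / (S - s))) := by
  have : 0 < S - s := sub_pos.2 hs
  rw [Real.exp_neg, Real.exp_log (by positivity)]
  field_simp

theorem log_div_sub_pos {S s : ℝ} (hs : s ∈ Ioo 0 S) : 0 < Real.log (S / (S - s)) := by
  have : 0 < S - s := sub_pos.2 hs.2
  exact Real.log_pos ((one_lt_div this).2 (by linarith [hs.1]))

theorem sub_rpow_eq {S s : ℝ} (hS : 0 < S) (hs : s < S) (a : ℝ) :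
    (S - s) ^ a = S ^ a * Real.exp (-a * Real.log (S / (S - s))) := by
  conv_lhs => rw [sub_eq_mul_exp_neg_log hS hs]
  rw [Real.mul_rpow hS.le (Real.exp_pos _).le, ← Real.exp_mul]
  ring_nf

theorem bridgeF_of_ne {S α s : ℝ} (hS : 0 < S) (hs : s < S) (hα : α ≠ 1 / 2) :
    bridgeF S α s
      = S * ((1 - Real.exp (-(1 - 2 * α) * Real.log (S / (S - s)))) / (1 - 2 * α)) := by
  have h : S ^ (2 * α) * S ^ (1 - 2 * α) = S := by
    rw [← Real.rpow_add hS]; simp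
  rw [bridgeF, if_neg hα, sub_rpow_eq hS hs]
  linear_combination
    ((1 - Real.exp (-(1 - 2 * α) * Real.log (S / (S - s)))) / (1 - 2 * α)) * h

/-- With `bridgeF_le`, this compares f with its form S·x at α = 1/2, up to exponentials in x, so
that all α are treated together. -/
theorem le_bridgeF {S α s : ℝ} (hS : 0 < S) (hs : s ∈ Ioo 0 S) :
    S * Real.log (S / (S - s)) * Real.exp (-|1 - 2 * α| * Real.log (S / (S - s)))
      ≤ bridgeF S α s := by
  have hx := log_div_sub_pos hs
  by_cases hα : α = 1 / 2
  · simp [bridgeF, hα]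
  · rw [bridgeF_of_ne hS hs.2 hα, mul_assoc]
    gcongr
    exact mul_exp_neg_abs_mul_le_div (fun h => hα (by linarith)) hx.le

theorem bridgeF_le {S α s : ℝ} (hS : 0 < S) (hs : s ∈ Ioo 0 S) :
    bridgeF S α s
      ≤ S * Real.log (S / (S - s))
        * Real.exp (max 0 (-(1 - 2 * α)) * Real.log (S / (S - s))) := by
  have hx := log_div_sub_pos hs
  by_cases hα : α = 1 / 2
  · simp [bridgeF, hα]
  · rw [bridgeF_of_ne hS hs.2 hα, mul_assoc]
    gcongr
    exact div_le_mul_exp_max_mul (fun h => hα (by linarith)) _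

theorem bridgeF_pos {S α s : ℝ} (hS : 0 < S) (hs : s ∈ Ioo 0 S) : 0 < bridgeF S α s := by
  have hx := log_div_sub_pos hs
  exact lt_of_lt_of_le (by positivity) (le_bridgeF hS hs)

theorem abs_log_bridgeF_le {S α s : ℝ} (hS : 0 < S) (hs : s ∈ Ioo 0 S) :
    |Real.log (bridgeF S α s)| ≤ |Real.log (S * Real.log (S / (S - s)))|
      + |1 - 2 * α| * Real.log (S / (S - s)) := by
  have hx := log_div_sub_pos hs
  have hSx := mul_pos hS hx
  have h1 := Real.log_le_log (by positivity) (le_bridgeF (α := α) hS hs)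
  have h2 := Real.log_le_log (bridgeF_pos hS hs) (bridgeF_le (α := α) hS hs)
  rw [Real.log_mul hSx.ne' (Real.exp_pos _).ne', Real.log_exp] at h1 h2
  have h3 : max 0 (-(1 - 2 * α)) ≤ |1 - 2 * α| := max_le (abs_nonneg _) (neg_le_abs _)
  have h4 := mul_le_mul_of_nonneg_right h3 hx.le
  have h5 := neg_abs_le (Real.log (S * Real.log (S / (S - s))))
  have h6 := le_abs_self (Real.log (S * Real.log (S / (S - s))))
  rw [abs_le]
  constructor <;> linarith

theorem bridgeSqrtG_eq {S α s : ℝ} (hS : 0 < S) (hs : s < S) :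
    bridgeSqrtG S α s = Real.exp (-α * Real.log (S / (S - s))) * √(bridgeF S α s) := by
  by_cases hα : α = 1 / 2
  · have hSs := sub_eq_mul_exp_neg_log hS hs
    rw [bridgeSqrtG, if_pos hα, bridgeF, if_pos hα]
    set x := Real.log (S / (S - s))
    have h : Real.exp (-α * x) = √(Real.exp (-x)) := by
      rw [← Real.exp_half, hα]; ring_nf
    rw [hSs, h, ← Real.sqrt_mul (Real.exp_pos _).le]
    ring_nf
  · rw [bridgeSqrtG, if_neg hα, bridgeF, if_neg hα, sub_rpow_eq hS hs α]
    have h : √(S ^ (2 * α)) = S ^ α := by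
      rw [mul_comm, Real.rpow_mul hS.le, Real.rpow_two, Real.sqrt_sq (by positivity)]
    rw [div_mul_eq_mul_div, mul_div_assoc, Real.sqrt_mul (by positivity), h]
    ring

theorem bridgeSqrtG_nonneg {S α s : ℝ} (hS : 0 < S) (hs : s < S) : 0 ≤ bridgeSqrtG S α s := by
  rw [bridgeSqrtG_eq hS hs]
  positivity

/-- The possible growth exp((2α-1)x) of f contributes its square root against exp(-αx). The net
decay rate is min(α, 1/2), positive exactly when α > 0. -/
theorem bridgeSqrtG_le {S α s : ℝ} (hS : 0 < S) (hs : s ∈ Ioo 0 S) :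
    bridgeSqrtG S α s ≤ √(S * Real.log (S / (S - s)))
      * Real.exp (-(min (2 * α) 1 / 2) * Real.log (S / (S - s))) := by
  have hx := log_div_sub_pos hs
  rw [bridgeSqrtG_eq hS hs.2]
  calc _ ≤ Real.exp (-α * Real.log (S / (S - s))) * √(S * Real.log (S / (S - s))
        * Real.exp (max 0 (-(1 - 2 * α)) * Real.log (S / (S - s)))) := by
        gcongr
        exact bridgeF_le hS hs
    _ = _ := by
        rw [Real.sqrt_mul (by positivity), ← Real.exp_half, mul_left_comm, ← Real.exp_add]
        congr 2
        rcases le_total (2 * α) 1 with h | h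
        · rw [min_eq_left h, max_eq_left (by linarith)]; ring
        · rw [min_eq_right h, max_eq_right (by linarith)]; ring

/-! ### The one-dimensional covariance identity -/

theorem bridgeF_mono {S α s₁ s₂ : ℝ} (h : s₁ ≤ s₂) (hs₂ : s₂ < S) (hS : 0 < S) :
    bridgeF S α s₁ ≤ bridgeF S α s₂ := by
  have h2 : 0 < S - s₂ := sub_pos.2 hs₂
  unfold bridgeF
  split_ifs with hα
  · gcongr
    exact div_pos hS (by linarith)
  · rcases lt_or_gt_of_ne hα with h1 | h1
    · have hc : 0 < 1 - 2 * α := by linarith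
      have := Real.rpow_le_rpow h2.le (sub_le_sub_left h S) hc.le
      gcongr
    · have hc : 1 - 2 * α < 0 := by linarith
      have := Real.rpow_le_rpow_of_nonpos h2 (sub_le_sub_left h S) hc.le
      -- For α > 1/2 both the prefactor and the difference of powers are nonpositive, so the order
      -- is reversed twice.
      refine mul_le_mul_of_nonpos_left (by linarith) ?_
      exact div_nonpos_of_nonneg_of_nonpos (by positivity) hc.le

theorem scaledBridgeCov_of_le {S α s₁ s₂ : ℝ} (hS : 0 < S) (h : s₁ ≤ s₂) (hs : s₂ < S) :
    scaledBridgeCov S α s₁ s₂ = Real.exp (-α * Real.log (S / (S - s₁)))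
      * Real.exp (-α * Real.log (S / (S - s₂))) * bridgeF S α s₁ := by
  have hs₁ := h.trans_lt hs
  rw [scaledBridgeCov, if_neg (by simp [hs.ne, hs₁.ne]), min_eq_left h, bridgeF]
  split_ifs with hα
  · have e : √((S - s₁) * (S - s₂)) = S * (Real.exp (-α * Real.log (S / (S - s₁)))
        * Real.exp (-α * Real.log (S / (S - s₂)))) := by
      have e₁ := sub_eq_mul_exp_neg_log hS hs₁
      have e₂ := sub_eq_mul_exp_neg_log hS hs
      set x₁ := Real.log (S / (S - s₁))
      set x₂ := Real.log (S / (S - s₂))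
      rw [← Real.sqrt_sq (by positivity : 0 ≤ S * (Real.exp (-α * x₁) * Real.exp (-α * x₂))),
        mul_pow, mul_pow, ← Real.exp_nat_mul, ← Real.exp_nat_mul, e₁, e₂, hα]
      push_cast
      ring_nf
    rw [e]
    ring
  · rw [sub_rpow_eq hS hs₁ α, sub_rpow_eq hS hs α]
    have e : S ^ (2 * α) = S ^ α * S ^ α := by rw [← Real.rpow_add hS]; ring_nf
    rw [e]
    ring

theorem scaledBridgeCov_comm (S α s₁ s₂ : ℝ) :
    scaledBridgeCov S α s₁ s₂ = scaledBridgeCov S α s₂ s₁ := by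
  unfold scaledBridgeCov
  simp only [min_comm s₁, or_comm (a := s₁ = S), mul_comm (S - s₁), mul_comm ((S - s₁) ^ α)]

theorem scaledBridgeCov_eq {S α s₁ s₂ : ℝ} (hS : 0 < S) (h₁ : s₁ ∈ Ioo 0 S) (h₂ : s₂ ∈ Ioo 0 S) :
    scaledBridgeCov S α s₁ s₂ = bridgeSqrtG S α s₁ * bridgeSqrtG S α s₂
      * Real.exp (-(1 / 2) * |Real.log (bridgeF S α s₂) - Real.log (bridgeF S α s₁)|) := by
  wlog h : s₁ ≤ s₂ generalizing s₁ s₂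
  · rw [scaledBridgeCov_comm, this h₂ h₁ (le_of_not_ge h), abs_sub_comm]
    ring
  have f₁ := bridgeF_pos (α := α) hS h₁
  have f₂ := bridgeF_pos (α := α) hS h₂
  have hle := Real.log_le_log f₁ (bridgeF_mono h h₂.2 hS)
  rw [scaledBridgeCov_of_le hS h h₂.2, bridgeSqrtG_eq hS h₁.2, bridgeSqrtG_eq hS h₂.2,
    abs_of_nonneg (sub_nonneg.2 hle)]
  have e : Real.exp (-(1 / 2) * (Real.log (bridgeF S α s₂) - Real.log (bridgeF S α s₁)))
      = √(bridgeF S α s₁) / √(bridgeF S α s₂) := by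
    rw [← Real.sqrt_div f₁.le, ← Real.exp_log (div_pos f₁ f₂), ← Real.exp_half,
      Real.log_div f₁.ne' f₂.ne']
    ring_nf
  rw [e]
  have := Real.sqrt_pos.2 f₂
  have e₁ := Real.mul_self_sqrt f₁.le
  field_simp
  rw [Real.sq_sqrt f₁.le]

theorem scaledBridgeCov_eq_zero {S α s₁ s₂ : ℝ} (h₁ : s₁ ∈ Icc 0 S) (h₂ : s₂ ∈ Icc 0 S)
    (h : s₁ ∉ Ioo 0 S ∨ s₂ ∉ Ioo 0 S) : scaledBridgeCov S α s₁ s₂ = 0 := by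
  wlog h' : s₁ ∉ Ioo 0 S generalizing s₁ s₂
  · rw [scaledBridgeCov_comm, this h₂ h₁ h.symm (h.resolve_left h')]
  by_cases hs : s₁ = S ∨ s₂ = S
  · rw [scaledBridgeCov, if_pos hs]
  · have h0 : s₁ = 0 := by
      by_contra hne
      exact h' ⟨lt_of_le_of_ne h₁.1 (Ne.symm hne), lt_of_le_of_ne h₁.2 (fun e => hs (Or.inl e))⟩
    have hS : S ≠ 0 := fun e => hs (Or.inl (h0.trans e.symm))
    rw [scaledBridgeCov, if_neg hs, h0, min_eq_left h₂.1]
    simp [div_self hS]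

/-! ### Decay of the amplitude against logarithmic growth -/

theorem tendsto_sqrt_mul_exp_mul_log_sq_nhdsGT_zero (κ A : ℝ) :
    Tendsto (fun y : ℝ => √y * Real.exp (-κ * y) * (1 + (|Real.log y| + A * y) ^ 2))
      (𝓝[>] 0) (𝓝 0) := by
  have h1 : Tendsto (fun y : ℝ => √y * Real.exp (-κ * y)) (𝓝[>] 0) (𝓝 0) := by
    have : Continuous fun y : ℝ => √y * Real.exp (-κ * y) := by fun_prop
    simpa using (this.tendsto 0).mono_left nhdsWithin_le_nhds
  have h2 : Tendsto (fun y : ℝ => |Real.log y * y ^ (1 / 4 : ℝ)| + A * y * y ^ (1 / 4 : ℝ))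
      (𝓝[>] 0) (𝓝 0) := by
    have h3 := (tendsto_log_mul_rpow_nhdsGT_zero (r := 1 / 4) (by norm_num)).abs
    have : Continuous fun y : ℝ => A * y * y ^ (1 / 4 : ℝ) :=
      (by fun_prop : Continuous fun y : ℝ => A * y).mul
        (Real.continuous_rpow_const (by norm_num))
    have h4 := (this.tendsto 0).mono_left (nhdsWithin_le_nhds (s := Ioi 0))
    simpa using h3.add h4
  have h5 : Tendsto (fun y : ℝ => Real.exp (-κ * y)) (𝓝[>] 0) (𝓝 1) := by
    have : Continuous fun y : ℝ => Real.exp (-κ * y) := by fun_prop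
    simpa using (this.tendsto 0).mono_left nhdsWithin_le_nhds
  have h6 := h1.add (h5.mul (h2.pow 2))
  simp only [ne_eq, OfNat.ofNat_ne_zero, not_false_eq_true, zero_pow, mul_zero, add_zero] at h6
  refine h6.congr' ?_
  filter_upwards [self_mem_nhdsWithin] with y hy
  have hy0 : 0 < y := hy
  -- Splitting √y as the square of y^(1/4) lets one factor enter the squared bracket, where
  -- y^(1/4)·ln y tends to 0.
  have e : √y = (y ^ (1 / 4 : ℝ)) ^ 2 := by
    rw [← Real.rpow_natCast, ← Real.rpow_mul hy0.le, Real.sqrt_eq_rpow]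
    norm_num
  rw [abs_mul, abs_of_nonneg (Real.rpow_nonneg hy0.le _), e]
  ring

theorem tendsto_sqrt_mul_exp_mul_log_sq_atTop {κ A : ℝ} (hκ : 0 < κ) (hA : 0 ≤ A) :
    Tendsto (fun y : ℝ => √y * Real.exp (-κ * y) * (1 + (|Real.log y| + A * y) ^ 2))
      atTop (𝓝 0) := by
  have h := tendsto_rpow_mul_exp_neg_mul_atTop_nhds_zero (3 : ℕ) κ hκ
  have h' := h.const_mul (1 + (1 + A) ^ 2)
  rw [mul_zero] at h'
  refine squeeze_zero' (Eventually.of_forall fun y => by positivity) ?_ h'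
  filter_upwards [eventually_ge_atTop 1] with y hy
  have h1 : |Real.log y| ≤ y := by
    rw [abs_of_nonneg (Real.log_nonneg hy)]
    exact Real.log_le_self (by linarith)
  have h2 : √y ≤ y := by
    rw [Real.sqrt_le_left (by linarith)]
    nlinarith
  have h3 : 1 + (|Real.log y| + A * y) ^ 2 ≤ (1 + (1 + A) ^ 2) * y ^ 2 := by
    have : (|Real.log y| + A * y) ^ 2 ≤ ((1 + A) * y) ^ 2 := by
      have : 0 ≤ A * y := by positivity
      gcongr
      linarith
    nlinarith
  rw [Real.rpow_natCast]
  calc _ ≤ y * Real.exp (-κ * y) * ((1 + (1 + A) ^ 2) * y ^ 2) := by gcongr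
    _ = _ := by ring

theorem tendsto_log_div_sub_nhds_zero {S : ℝ} (hS : 0 < S) :
    Tendsto (fun s => Real.log (S / (S - s))) (𝓝[Ioo 0 S] 0) (𝓝[>] 0) := by
  refine tendsto_nhdsWithin_iff.2 ⟨?_, ?_⟩
  · have : ContinuousAt (fun s => Real.log (S / (S - s))) 0 := by
      refine ContinuousAt.log (ContinuousAt.div (by fun_prop) (by fun_prop) ?_) ?_ <;>
        simp [hS.ne']
    simpa [ContinuousAt, hS.ne'] using this.tendsto.mono_left (nhdsWithin_le_nhds (s := Ioo 0 S))
  · filter_upwards [self_mem_nhdsWithin] with s hs using log_div_sub_pos hs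

theorem tendsto_log_div_sub_atTop {S : ℝ} (hS : 0 < S) :
    Tendsto (fun s => Real.log (S / (S - s))) (𝓝[Ioo 0 S] S) atTop := by
  refine Real.tendsto_log_atTop.comp ?_
  simp_rw [div_eq_mul_inv]
  refine Tendsto.const_mul_atTop hS (tendsto_inv_nhdsGT_zero.comp
    (tendsto_nhdsWithin_iff.2 ⟨?_, ?_⟩))
  · have : Continuous fun s => S - s := by fun_prop
    simpa using (this.tendsto S).mono_left nhdsWithin_le_nhds
  · filter_upwards [self_mem_nhdsWithin] with s hs using sub_pos.2 hs.2

/-- Written in y = S·x, whence the divisions by S: the right side is then the function whose limits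
at 0 and ∞ are known. -/
theorem bridgeSqrtG_mul_le {S α s : ℝ} (hS : 0 < S) (hs : s ∈ Ioo 0 S) :
    bridgeSqrtG S α s * (1 + Real.log (bridgeF S α s) ^ 2) ≤
      √(S * Real.log (S / (S - s)))
        * Real.exp (-(min (2 * α) 1 / 2 / S) * (S * Real.log (S / (S - s))))
        * (1 + (|Real.log (S * Real.log (S / (S - s)))|
          + |1 - 2 * α| / S * (S * Real.log (S / (S - s)))) ^ 2) := by
  have h1 := bridgeSqrtG_le (α := α) hS hs
  have h2 := abs_log_bridgeF_le (α := α) hS hs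
  have e : ∀ a : ℝ, a / S * (S * Real.log (S / (S - s))) = a * Real.log (S / (S - s)) := by
    intro a; field_simp
  rw [← neg_div, e, e, ← sq_abs (Real.log (bridgeF S α s))]
  gcongr

/-- The amplitude of the scaled field along one axis, with the factor that dominates the growth
of a stationary Ornstein-Uhlenbeck field at the transformed time. -/
noncomputable def bridgeEnvelope (S α s : ℝ) : ℝ :=
  if 0 < s ∧ s < S then bridgeSqrtG S α s * (1 + Real.log (bridgeF S α s) ^ 2) else 0

theorem continuousAt_log_div_sub {S s : ℝ} (hS : 0 < S) (hs : s < S) :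
    ContinuousAt (fun s => Real.log (S / (S - s))) s :=
  ContinuousAt.log (ContinuousAt.div (by fun_prop) (by fun_prop) (sub_pos.2 hs).ne')
    (div_pos hS (sub_pos.2 hs)).ne'

theorem continuousAt_bridgeF {S α s : ℝ} (hS : 0 < S) (hs : s < S) :
    ContinuousAt (bridgeF S α) s := by
  have hx := continuousAt_log_div_sub hS hs
  by_cases hα : α = 1 / 2
  · have : bridgeF S α = fun s => S * Real.log (S / (S - s)) := by
      ext; rw [bridgeF, if_pos hα]
    rw [this]
    exact continuousAt_const.mul hx
  · refine ContinuousAt.congr (f := fun s =>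
      S * ((1 - Real.exp (-(1 - 2 * α) * Real.log (S / (S - s)))) / (1 - 2 * α))) ?_ ?_
    · fun_prop
    · filter_upwards [eventually_lt_nhds hs] with t ht using (bridgeF_of_ne hS ht hα).symm

theorem continuousAt_bridgeSqrtG {S α s : ℝ} (hS : 0 < S) (hs : s < S) :
    ContinuousAt (bridgeSqrtG S α) s := by
  have hx := continuousAt_log_div_sub hS hs
  have hf := continuousAt_bridgeF (α := α) hS hs
  refine ContinuousAt.congr (f := fun s =>
    Real.exp (-α * Real.log (S / (S - s))) * √(bridgeF S α s)) (by fun_prop) ?_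
  filter_upwards [eventually_lt_nhds hs] with t ht using (bridgeSqrtG_eq hS ht).symm

theorem continuousOn_bridgeEnvelope {S α : ℝ} (hS : 0 < S) (hα : 0 < α) :
    ContinuousOn (bridgeEnvelope S α) (Icc 0 S) := by
  intro s hs
  refine ContinuousAt.continuousWithinAt ?_
  have key : ∀ s₀, ¬ (0 < s₀ ∧ s₀ < S) →
      Tendsto (fun s => bridgeSqrtG S α s * (1 + Real.log (bridgeF S α s) ^ 2))
        (𝓝[Ioo 0 S] s₀) (𝓝 0) → ContinuousAt (bridgeEnvelope S α) s₀ := by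
    intro s₀ h₀ h
    rw [ContinuousAt, show bridgeEnvelope S α s₀ = 0 from if_neg h₀]
    exact Tendsto.if h tendsto_const_nhds
  have hnn : ∀ᶠ s in 𝓟 (Ioo 0 S),
      0 ≤ bridgeSqrtG S α s * (1 + Real.log (bridgeF S α s) ^ 2) :=
    eventually_principal.2 fun s hs =>
      mul_nonneg (bridgeSqrtG_nonneg hS hs.2) (by positivity)
  have hle := eventually_principal.2 fun s hs => bridgeSqrtG_mul_le (α := α) (s := s) hS hs
  rcases hs.1.eq_or_lt with h0 | h0
  · subst h0
    refine key _ (by simp) (squeeze_zero' (hnn.filter_mono inf_le_right)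
      (hle.filter_mono inf_le_right) ?_)
    refine (tendsto_sqrt_mul_exp_mul_log_sq_nhdsGT_zero _ _).comp (tendsto_nhdsWithin_iff.2 ⟨?_, ?_⟩)
    · simpa using ((tendsto_log_div_sub_nhds_zero hS).mono_right nhdsWithin_le_nhds).const_mul S
    · filter_upwards [self_mem_nhdsWithin] with s hs using mul_pos hS (log_div_sub_pos hs)
  rcases hs.2.eq_or_lt with h1 | h1
  · subst h1
    refine key _ (by simp) (squeeze_zero' (hnn.filter_mono inf_le_right)
      (hle.filter_mono inf_le_right) ?_)
    exact (tendsto_sqrt_mul_exp_mul_log_sq_atTop (by positivity) (by positivity)).comp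
      ((tendsto_log_div_sub_atTop hS).const_mul_atTop hS)
  · have hf := (continuousAt_bridgeF (α := α) hS h1).log (bridgeF_pos hS ⟨h0, h1⟩).ne'
    have hg := continuousAt_bridgeSqrtG (α := α) hS h1
    refine ContinuousAt.congr (f := fun s =>
      bridgeSqrtG S α s * (1 + Real.log (bridgeF S α s) ^ 2)) (by fun_prop) ?_
    filter_upwards [Ioo_mem_nhds h0 h1] with t ht
    exact (if_pos ht).symm

theorem bridgeEnvelope_nonneg {S : ℝ} (hS : 0 < S) (α s : ℝ) : 0 ≤ bridgeEnvelope S α s := by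
  unfold bridgeEnvelope
  split_ifs with h
  · exact mul_nonneg (bridgeSqrtG_nonneg hS h.2) (by positivity)
  · exact le_rfl

/-! ### The scaled field -/

theorem sqrt_bridgeG_mul_bridgeG {S T α β s t : ℝ} (hS : 0 < S) (hT : 0 < T) (hs : s < S)
    (ht : t < T) :
    √(bridgeG S α s * bridgeG T β t) = bridgeSqrtG S α s * bridgeSqrtG T β t := by
  rw [bridgeG, bridgeG, ← mul_pow,
    Real.sqrt_sq (mul_nonneg (bridgeSqrtG_nonneg hS hs) (bridgeSqrtG_nonneg hT ht))]

/-- The deterministic amplitude of the scaled field. -/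
noncomputable def bridgeAmplitude (S T α β : ℝ) (p : ℝ × ℝ) : ℝ :=
  if (0 < p.1 ∧ p.1 < S) ∧ (0 < p.2 ∧ p.2 < T) then bridgeSqrtG S α p.1 * bridgeSqrtG T β p.2
  else 0

/-- Off the open rectangle the amplitude is 0, so the meaningless values of the logarithms there do
no harm and no case split is needed downstream. -/
theorem scaledField_eq {Ω : Type*} {S T α β : ℝ} (hS : 0 < S) (hT : 0 < T)
    (X : ℝ × ℝ → Ω → ℝ) (p : ℝ × ℝ) :
    scaledField S T α β X p = fun ω => bridgeAmplitude S T α β p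
      * X (Real.log (bridgeF S α p.1), Real.log (bridgeF T β p.2)) ω := by
  ext ω
  unfold scaledField bridgeAmplitude
  split_ifs with h
  · rw [sqrt_bridgeG_mul_bridgeG hS hT h.1.2 h.2.2]
  · rw [zero_mul]

theorem abs_scaledField_le {Ω : Type*} {S T α β C : ℝ} (hS : 0 < S) (hT : 0 < T)
    {X : ℝ × ℝ → Ω → ℝ} {ω : Ω}
    (hC : ∀ u v : ℝ, |X (u, v) ω| ≤ C * ((1 + u ^ 2) * (1 + v ^ 2))) (p : ℝ × ℝ) :
    |scaledField S T α β X p ω|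
      ≤ C * (bridgeEnvelope S α p.1 * bridgeEnvelope T β p.2) := by
  have hC0 : 0 ≤ C := by simpa using (abs_nonneg _).trans (hC 0 0)
  by_cases h : (0 < p.1 ∧ p.1 < S) ∧ (0 < p.2 ∧ p.2 < T)
  · rw [scaledField_eq hS hT, bridgeAmplitude, if_pos h, bridgeEnvelope, if_pos h.1,
      bridgeEnvelope, if_pos h.2, abs_mul]
    have h1 := mul_nonneg (bridgeSqrtG_nonneg (α := α) hS h.1.2)
      (bridgeSqrtG_nonneg (α := β) hT h.2.2)
    rw [abs_of_nonneg h1]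
    refine (mul_le_mul_of_nonneg_left (hC _ _) h1).trans_eq (by ring)
  · rw [scaledField, if_neg h, abs_zero]
    exact mul_nonneg hC0 (mul_nonneg (bridgeEnvelope_nonneg hS _ _) (bridgeEnvelope_nonneg hT _ _))

theorem continuousOn_scaledField {Ω : Type*} {S T α β C : ℝ} (hS : 0 < S) (hT : 0 < T)
    (hα : 0 < α) (hβ : 0 < β) {X : ℝ × ℝ → Ω → ℝ} {ω : Ω} (hX : Continuous fun p => X p ω)
    (hC : ∀ u v : ℝ, |X (u, v) ω| ≤ C * ((1 + u ^ 2) * (1 + v ^ 2))) :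
    ContinuousOn (fun p => scaledField S T α β X p ω) (Icc 0 S ×ˢ Icc 0 T) := by
  intro p hp
  by_cases h : (0 < p.1 ∧ p.1 < S) ∧ (0 < p.2 ∧ p.2 < T)
  · refine ContinuousAt.continuousWithinAt ?_
    have hf₁ : ContinuousAt (fun q : ℝ × ℝ => bridgeF S α q.1) p :=
      (continuousAt_bridgeF hS h.1.2).comp continuousAt_fst
    have hf₂ : ContinuousAt (fun q : ℝ × ℝ => bridgeF T β q.2) p :=
      (continuousAt_bridgeF hT h.2.2).comp continuousAt_snd
    have hg₁ : ContinuousAt (fun q : ℝ × ℝ => bridgeSqrtG S α q.1) p :=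
      (continuousAt_bridgeSqrtG hS h.1.2).comp continuousAt_fst
    have hg₂ : ContinuousAt (fun q : ℝ × ℝ => bridgeSqrtG T β q.2) p :=
      (continuousAt_bridgeSqrtG hT h.2.2).comp continuousAt_snd
    have hXc := hX.continuousAt.comp ((hf₁.log (bridgeF_pos hS h.1).ne').prodMk
      (hf₂.log (bridgeF_pos hT h.2).ne'))
    refine ((hg₁.mul hg₂).mul hXc).congr ?_
    filter_upwards [(isOpen_Ioo.prod isOpen_Ioo).mem_nhds (⟨h.1, h.2⟩ : p ∈ Ioo 0 S ×ˢ Ioo 0 T)]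
      with q hq
    rw [scaledField_eq hS hT, bridgeAmplitude, if_pos ⟨hq.1, hq.2⟩]
    rfl
  · have h0 : scaledField S T α β X p ω = 0 := if_neg h
    -- At a boundary point one envelope vanishes and the other is merely finite. Joint continuity of
    -- their product covers edges and corners alike.
    have hb : C * (bridgeEnvelope S α p.1 * bridgeEnvelope T β p.2) = 0 := by
      rcases not_and_or.1 h with h | h <;> simp [bridgeEnvelope, h]
    rw [ContinuousWithinAt, h0]
    refine squeeze_zero_norm (fun q => abs_scaledField_le hS hT hC q) ?_
    have h1 := (continuousOn_bridgeEnvelope hS hα).comp continuousOn_fst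
      (fun q (hq : q ∈ Icc 0 S ×ˢ Icc 0 T) => hq.1)
    have h2 := (continuousOn_bridgeEnvelope hT hβ).comp continuousOn_snd
      (fun q (hq : q ∈ Icc 0 S ×ˢ Icc 0 T) => hq.2)
    have h3 : Tendsto (fun q : ℝ × ℝ => C * (bridgeEnvelope S α q.1 * bridgeEnvelope T β q.2))
        (𝓝[Icc 0 S ×ˢ Icc 0 T] p) (𝓝 (C * (bridgeEnvelope S α p.1 * bridgeEnvelope T β p.2))) :=
      (continuousOn_const.mul (h1.mul h2)) p hp
    rwa [hb] at h3

theorem proposition3 {Ω : Type*} [MeasurableSpace Ω] (P : Measure Ω) [IsProbabilityMeasure P]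
    (X : ℝ × ℝ → Ω → ℝ) (hX : IsStationaryOUField P (1 / 2) (1 / 2) 1 X)
    (S T α β : ℝ) (hS : 0 < S) (hT : 0 < T) (hα : 0 < α) (hβ : 0 < β) :
    IsTiedDownScaledWienerBridge P S T α β (scaledField S T α β X) where
  measurable p _ := by
    rw [scaledField_eq hS hT]
    exact (hX.measurable _ (mem_univ _)).const_mul _
  gaussian := by
    have h : IsGaussianProcess (fun p : (Icc 0 S ×ˢ Icc 0 T : Set (ℝ × ℝ)) =>
        X (Real.log (bridgeF S α p.1.1), Real.log (bridgeF T β p.1.2))) P :=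
      hX.gaussian.comp_right fun p : (Icc 0 S ×ˢ Icc 0 T : Set (ℝ × ℝ)) =>
        ⟨(Real.log (bridgeF S α p.1.1), Real.log (bridgeF T β p.1.2)), mem_univ _⟩
    exact (IsGaussianProcess.smul (E := ℝ) (fun p : (Icc 0 S ×ˢ Icc 0 T : Set (ℝ × ℝ)) =>
      bridgeAmplitude S T α β p) h).congr fun p =>
        Filter.EventuallyEq.of_eq (scaledField_eq hS hT X p).symm
  mean_zero p _ := by
    rw [scaledField_eq hS hT, integral_const_mul, hX.mean_zero _ (mem_univ _), mul_zero]
  continuous_paths := by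
    filter_upwards [hX.continuous_paths, ae_exists_growth_bound_of_isStationaryOUField hX]
      with ω hω ⟨C, hC⟩
    exact continuousOn_scaledField hS hT hα hβ (continuousOn_univ.1 hω) hC
  cov_eq p hp q hq := by
    rw [scaledField_eq hS hT, scaledField_eq hS hT, covariance_const_mul_left,
      covariance_const_mul_right, hX.cov_eq _ (mem_univ _) _ (mem_univ _)]
    by_cases hp' : (0 < p.1 ∧ p.1 < S) ∧ (0 < p.2 ∧ p.2 < T)
    · by_cases hq' : (0 < q.1 ∧ q.1 < S) ∧ (0 < q.2 ∧ q.2 < T)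
      · rw [scaledBridgeCov_eq hS hp'.1 hq'.1, scaledBridgeCov_eq hT hp'.2 hq'.2,
          bridgeAmplitude, if_pos hp', bridgeAmplitude, if_pos hq', sub_eq_add_neg, Real.exp_add,
          ← neg_mul]
        ring
      · rw [show bridgeAmplitude S T α β q = 0 from if_neg hq']
        rcases not_and_or.1 hq' with h | h
        · rw [scaledBridgeCov_eq_zero hp.1 hq.1 (Or.inr h)]; ring
        · rw [scaledBridgeCov_eq_zero hp.2 hq.2 (Or.inr h)]; ring
    · rw [show bridgeAmplitude S T α β p = 0 from if_neg hp']
      rcases not_and_or.1 hp' with h | h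
      · rw [scaledBridgeCov_eq_zero hp.1 hq.1 (Or.inl h)]; ring
      · rw [scaledBridgeCov_eq_zero hp.2 hq.2 (Or.inl h)]; ring
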